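/- **Model.** Consider a connected simple graph on $n$ anonymous nodes. At each node $v$ the incident edges carry distinct port numbers $0,\dots,\deg(v)-1$ (the two ends of an edge are numbered independently), and $v$ has a capacity $c(v)\in\mathbb{N}$ (possibly $0$). There are $k$ robots with distinct IDs in $\mathbb N$, placed arbitrarily on the nodes, and $\sum_v c(v)\ge k$. One robot is the *shepherd*; it is never Byzantine, and every robot can tell whether a co-located robot is the shepherd. All robots start at the same time, and time proceeds in synchronous rounds. In each round every robot perceives the degree and capacity of its node and the port through which it has just entered it (if it moved), shouts one message to all robots at its node together with an ID, and hears the IDs and messages of all robots there (one ID and one message per robot); it then computes with unlimited memory and stays, leaves through a port, or terminates, in which case it remains at its node forever. Non-Byzantine robots show their true IDs and follow a deterministic algorithm. At most $f$ robots are *strong Byzantine*: in every round they may show arbitrary IDs, shout arbitrary messages, and stay or move along an edge arbitrarily. Initially the shepherd knows $k$, $f$ and its ID; every other robot knows only its own ID (and not $n$, $k$ or $f$). *Byzantine dispersion* is solved within $R$ rounds if, after at most $R$ rounds, all non-Byzantine robots have terminated and each node $v$ holds at most $c(v)$ non-Byzantine robots. A *universal exploration sequence* (UXS) for size $n$ is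 a finite sequence of integers $x_1,\dots,x_L$ such that, in every connected port-numbered graph with at most $n$ nodes and from every start node, the following walk visits all nodes: first leave through port $0$; then, in step $i=1,\dots,L$, having entered the current node $u$ through port $p$, leave it through port $(p+x_i)\bmod\deg(u)$. The walk takes $L+1$ rounds. **Theorem 2.** There is a constant $C$ such that the following holds. Let a UXS for every size $n$ be fixed, and let $X(n)$ be the number of rounds of the walk along the UXS for size $n$. Then there is an algorithm which, for all $n$, $k$, $f$ with $f<(k-1)/3$, on every capacitated graph with $n$ nodes, from arbitrary initial positions of the $k$ robots, and for every behaviour of the at most $f$ strong Byzantine robots, solves Byzantine dispersion within $C\,(X(n)+n^3)$ rounds, that is, in $O(X(n)+n^3)$ rounds, where the shepherd knows $k$ and $f$. -/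

import Mathlib

/-- A connected simple graph on `n` nodes. At every node `v` the incident edges carry the distinct
port numbers `0, …, deg v - 1`; the two ends of an edge are numbered independently. -/
structure PortGraph (n : ℕ) where
  graph : SimpleGraph (Fin n)
  connected : graph.Connected
  deg : Fin n → ℕ
  port : ∀ v, Fin (deg v) ≃ graph.neighborSet v

/-- Leaving `v` through port `p`: the node that is reached and the port through which it is
entered; `none` if `v` has no port `p`. -/
def PortGraph.cross {n : ℕ} (G : PortGraph n) (v : Fin n) (p : ℕ) : Option (Fin n × ℕ) :=
  if h : p < G.deg v then
    some ((G.port v ⟨p, h⟩ : Fin n),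
      ((G.port (G.port v ⟨p, h⟩)).symm ⟨v, SimpleGraph.Adj.symm (G.port v ⟨p, h⟩).2⟩ : ℕ))
  else none

/-! ### Universal exploration sequences -/

/-- The nodes visited by a robot that is at node `a.1`, which it entered through port `a.2`, and
that follows the integers `x₁, x₂, …`: having entered a node `u` through port `p`, it leaves `u`
through port `(p + xᵢ) mod deg u`. (At an isolated node the robot stays.) -/
def PortGraph.visits {n : ℕ} (G : PortGraph n) : List ℤ → Fin n × ℕ → List (Fin n)
  | [], a => [a.1]
  | x :: xs, a =>
      a.1 :: G.visits xs ((G.cross a.1 (((a.2 : ℤ) + x) % (G.deg a.1 : ℤ)).toNat).getD (a.1, 0))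

/-- `x` is a universal exploration sequence for size `n`: in every connected port-numbered graph
with at most `n` nodes, and from every start node, a robot which first leaves through port `0` and
then follows `x` visits all nodes. (Leaving through port `0` is following the integer `0` after a
fictitious entry through port `0`.) -/
def IsUXS (n : ℕ) (x : List ℤ) : Prop :=
  ∀ m ≤ n, ∀ (G : PortGraph m) (start v : Fin m), v ∈ G.visits (0 :: x) (start, 0)

/-- Number of rounds of the exploration that follows `x`: the first move and one per entry. -/
def uxsRounds (x : List ℤ) : ℕ := x.length + 1

/-! Universal exploration sequences exist for every size. -/

theorem PortGraph.mem_visits_append_left {n : ℕ} (G : PortGraph n) (x y : List ℤ) :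
    ∀ (a : Fin n × ℕ) (v : Fin n), v ∈ G.visits x a → v ∈ G.visits (x ++ y) a := by
  induction x with
  | nil => intro a v h; cases y <;> simp_all [visits]
  | cons z x ih =>
    intro a v h
    simp only [visits, List.cons_append, List.mem_cons] at h ⊢
    exact h.imp id (ih _ _)

theorem PortGraph.mem_visits_append_right {n : ℕ} (G : PortGraph n) (x : List ℤ) :
    ∀ a : Fin n × ℕ, ∃ b : Fin n × ℕ, ∀ y v, v ∈ G.visits y b → v ∈ G.visits (x ++ y) a := by
  induction x with
  | nil => exact fun a => ⟨a, fun y v h => h⟩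
  | cons z x ih =>
    intro a
    obtain ⟨b, hb⟩ := ih ((G.cross a.1 (((a.2 : ℤ) + z) % (G.deg a.1 : ℤ)).toNat).getD (a.1, 0))
    refine ⟨b, fun y v h => ?_⟩
    simp only [visits, List.cons_append, List.mem_cons]
    exact Or.inr (hb y v h)

theorem PortGraph.exists_mem_visits {n : ℕ} (G : PortGraph n) (b : Fin n × ℕ) (v : Fin n) :
    ∃ y, v ∈ G.visits y b := by
  obtain ⟨u, p⟩ := b
  obtain ⟨w⟩ := G.connected.preconnected u v
  induction w generalizing p with
  | nil => exact ⟨[], by simp [visits]⟩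
  | @cons u u' v h w ih =>
    obtain ⟨i, hi⟩ := (G.port u).surjective ⟨u', h⟩
    have hc : ∃ q, G.cross u i = some (u', q) := by
      have hp : (G.port u ⟨i, i.2⟩ : Fin n) = u' := by rw [Fin.eta, hi]
      rw [cross, dif_pos i.2]
      exact ⟨_, congrArg some (Prod.ext hp rfl)⟩
    obtain ⟨q, hq⟩ := hc
    obtain ⟨y, hy⟩ := ih q
    refine ⟨((i : ℕ) - p : ℤ) :: y, ?_⟩
    have hm : (((p : ℤ) + (((i : ℕ) : ℤ) - p)) % (G.deg u : ℤ)).toNat = i := by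
      rw [add_sub_cancel, Int.emod_eq_of_lt (by positivity) (by exact_mod_cast i.2)]
      simp
    simp only [visits, List.mem_cons, hm, hq, Option.getD_some]
    exact Or.inr hy

instance PortGraph.finite (n : ℕ) : Finite (PortGraph n) := by
  refine Finite.of_surjective
    (α := Σ g : {g : SimpleGraph (Fin n) // g.Connected}, Σ d : Fin n → Fin (n + 1),
      ∀ v, Fin (d v) ≃ g.1.neighborSet v)
    (fun x => ⟨x.1.1, x.1.2, fun v => x.2.1 v, x.2.2⟩) fun G => ?_
  have hd : ∀ v, G.deg v < n + 1 := fun v => Nat.lt_succ_of_le <| by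
    have := Fintype.card_le_of_injective (fun i => (G.port v i : Fin n))
      (Subtype.val_injective.comp (G.port v).injective)
    simpa using this
  exact ⟨⟨⟨G.graph, G.connected⟩, fun v => ⟨G.deg v, hd v⟩, G.port⟩, rfl⟩

theorem exists_isUXS (n : ℕ) : ∃ x, IsUXS n x := by
  classical
  have key : ∀ s : Finset (Σ m : Fin (n + 1), PortGraph m × Fin m × Fin m),
      ∃ x, ∀ a ∈ s, a.2.2.2 ∈ a.2.1.visits (0 :: x) (a.2.2.1, 0) := by
    intro s
    induction s using Finset.induction_on with
    | empty => exact ⟨[], by simp⟩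
    | insert a s _ ih =>
      obtain ⟨x, hx⟩ := ih
      obtain ⟨b, hb⟩ := a.2.1.mem_visits_append_right (0 :: x) (a.2.2.1, 0)
      obtain ⟨y, hy⟩ := a.2.1.exists_mem_visits b a.2.2.2
      refine ⟨x ++ y, fun c hc => ?_⟩
      rcases Finset.mem_insert.1 hc with rfl | hc
      · exact hb y _ hy
      · exact c.2.1.mem_visits_append_left (0 :: x) y _ _ (hx c hc)
  have := Fintype.ofFinite (Σ m : Fin (n + 1), PortGraph m × Fin m × Fin m)
  obtain ⟨x, hx⟩ := key Finset.univ
  exact ⟨x, fun m hm G s v => hx ⟨⟨m, Nat.lt_succ_of_le hm⟩, G, s, v⟩ (Finset.mem_univ _)⟩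

/-! ### Robots and algorithms -/

/-- What a robot perceives of its node: the degree, the capacity, and the port through which it
entered in the preceding round (`none` if it did not move). -/
structure LocalView where
  degree : ℕ
  capacity : ℕ
  entry : Option ℕ

/-- What a robot perceives of a co-located robot: the ID it claims, whether it is the shepherd, and
the message it shouts (`none` for a silent robot, in particular for a terminated one). -/
structure Sighting (Msg : Type) where
  label : ℕ
  isShepherd : Bool
  msg : Option Msg

/-- The decision of a robot at the end of the computation of a round: to go on with a new memory
state, staying at the node (`none`) or leaving through a port (`some p`), or to terminate. -/
inductive Decision (State : Type) where
  | go (s : State) (port : Option ℕ) : Decision State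
  | terminate : Decision State

/-- A deterministic distributed algorithm for robots with unlimited memory. Initially the shepherd
knows `k`, `f` and its own ID, and every other robot knows its own ID only. In each round a robot
shouts a message to all co-located robots, and then makes its decision from its memory, its view of
the node and the multiset of its sightings of the co-located robots. -/
structure Algorithm where
  Msg : Type
  State : Type
  initShepherd : (k f id : ℕ) → State
  initOther : (id : ℕ) → State
  shout : State → LocalView → Msg
  step : State → LocalView → Multiset (Sighting Msg) → Decision State

/-- An input with `k` robots on a capacitated graph of `n` nodes: capacities, IDs, initial
positions, the shepherd and the set of Byzantine robots. -/
structure Instance (n k : ℕ) where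
  G : PortGraph n
  cap : Fin n → ℕ
  id : Fin k → ℕ
  start : Fin k → Fin n
  shepherd : Fin k
  byz : Finset (Fin k)

/-- The instances with at most `f` Byzantine robots: the IDs are distinct, the shepherd is not
Byzantine, and the total capacity is at least the number of robots. -/
structure Instance.Valid {n k : ℕ} (I : Instance n k) (f : ℕ) : Prop where
  id_injective : Function.Injective I.id
  shepherd_honest : I.shepherd ∉ I.byz
  card_byz : I.byz.card ≤ f
  total_cap : k ≤ ∑ v, I.cap v

/-- The history of all robots; time `t` is the beginning of round `t`, counted from `0`. For robot
`i` at time `t`: its node, the port through which it has just entered, its memory state (`none` once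
it has terminated; meaningless for Byzantine robots), and the ID and message it shows to the
co-located robots in round `t`. -/
structure Trace (n k : ℕ) (A : Algorithm) where
  pos : ℕ → Fin k → Fin n
  entry : ℕ → Fin k → Option ℕ
  state : ℕ → Fin k → Option A.State
  label : ℕ → Fin k → ℕ
  msg : ℕ → Fin k → Option A.Msg

namespace Trace

variable {n k : ℕ} {A : Algorithm}

def view (I : Instance n k) (τ : Trace n k A) (t : ℕ) (i : Fin k) : LocalView where
  degree := I.G.deg (τ.pos t i)
  capacity := I.cap (τ.pos t i)
  entry := τ.entry t i

/-- The sightings that robot `i` makes in round `t` of the other robots at its node. -/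
def heard (I : Instance n k) (τ : Trace n k A) (t : ℕ) (i : Fin k) :
    Multiset (Sighting A.Msg) :=
  (Finset.univ.filter fun j => j ≠ i ∧ τ.pos t j = τ.pos t i).val.map fun j =>
    ⟨τ.label t j, decide (j = I.shepherd), τ.msg t j⟩

/-- State, node and entry port after a decision taken at node `v`. -/
def outcome {S : Type} (G : PortGraph n) (v : Fin n) :
    Decision S → Option S × Fin n × Option ℕ
  | .terminate => (none, v, none)
  | .go s none => (some s, v, none)
  | .go s (some p) =>
      match G.cross v p with
      | none => (some s, v, none)
      | some (w, q) => (some s, w, some q)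

/-- State, node and entry port at time `t + 1` of a robot `i` that follows the algorithm; a
terminated robot stays where it is. -/
def next (I : Instance n k) (τ : Trace n k A) (t : ℕ) (i : Fin k) :
    Option A.State × Fin n × Option ℕ :=
  match τ.state t i with
  | none => (none, τ.pos t i, none)
  | some s => outcome I.G (τ.pos t i) (A.step s (τ.view I t i) (τ.heard I t i))

/-- `τ` is a possible execution of `A` on `I`, where `A` is told the bound `f`: the other robots
follow the algorithm, show their true IDs and shout what the algorithm says, while the Byzantine
robots show arbitrary IDs and messages and stay or move along edges arbitrarily. -/
structure IsExecution (I : Instance n k) (f : ℕ) (τ : Trace n k A) : Prop where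
  pos_zero : ∀ i, τ.pos 0 i = I.start i
  entry_zero : ∀ i ∉ I.byz, τ.entry 0 i = none
  state_zero : ∀ i ∉ I.byz, τ.state 0 i =
    some (if i = I.shepherd then A.initShepherd k f (I.id i) else A.initOther (I.id i))
  label_eq : ∀ t, ∀ i ∉ I.byz, τ.label t i = I.id i
  msg_eq : ∀ t, ∀ i ∉ I.byz, τ.msg t i = (τ.state t i).map fun s => A.shout s (τ.view I t i)
  follow : ∀ t, ∀ i ∉ I.byz,
    (τ.state (t + 1) i, τ.pos (t + 1) i, τ.entry (t + 1) i) = τ.next I t i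
  byz_move : ∀ t, ∀ i ∈ I.byz,
    τ.pos (t + 1) i = τ.pos t i ∨ I.G.graph.Adj (τ.pos t i) (τ.pos (t + 1) i)

/-- Byzantine dispersion is achieved at time `T`, i.e. after `T` rounds: all non-Byzantine robots
have terminated, and every node holds at most as many of them as its capacity. -/
def DispersedAt (I : Instance n k) (τ : Trace n k A) (T : ℕ) : Prop :=
  (∀ i ∉ I.byz, τ.state T i = none) ∧
    ∀ v, (Finset.univ.filter fun i => i ∉ I.byz ∧ τ.pos T i = v).card ≤ I.cap v

end Trace

/-- The algorithm `A`, whose shepherd is told `k` and `f`, solves Byzantine dispersion of `k`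
robots, at most `f` of them Byzantine, on every capacitated graph with `n` nodes within `R` rounds,
whatever the initial positions and whatever the Byzantine robots do. -/
def Algorithm.SolvesByzantineDispersion (A : Algorithm) (n k f R : ℕ) : Prop :=
  ∀ I : Instance n k, I.Valid f → ∀ τ : Trace n k A, τ.IsExecution I f →
    ∃ T ≤ R, τ.DispersedAt I T

/-!
To gather, the shepherd takes all robots that it meets along with it. As it does not know `n`, it
walks in turn along sequences for the budgets `2 ^ j`, each of which is universal for as many nodes
as its budget permits; these walks take `O(X(n))` rounds until one of them visits all nodes. The
shepherd stops as soon as it sees `k - f - 1` other robots, of which more than `f` are honest.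

A group of more than `f` robots that say that they have joined cannot be faked by `f` Byzantine
robots, so the herd serves as a token with which the shepherd surveys the graph. It keeps a closed
tour. In order to check a port of a node on the tour, it leaves the herd at the far end of the port
and searches the whole tour for it; if the herd is not found, then the far end is a new node, and
the tour gets a detour to it. A port costs `O(n)` rounds, and there are at most `n ^ 2` ports.

Finally all other honest robots are with the shepherd. It lists the labels it sees and leads the
robots along the tour once more, leaving at each new node as many of the listed ones as the node can
hold. Byzantine robots may add wrong labels, but the list has fewer than `k` entries, so the total
capacity suffices for all entries and the shepherd itself.
-/

/-! ### Walks through ports -/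

namespace PortGraph

/-- A step of a walk: the port through which it leaves its node, and whether the node that it enters
is recorded as a new one. -/
structure Step where
  port : ℕ
  new : Bool
deriving DecidableEq

variable {n : ℕ} (G : PortGraph n)

/-- The node and the entry port of a robot that stays at `v` (`none`) or leaves it through a port.
If there is no such port, then the robot stays. -/
def leave (v : Fin n) (p : Option ℕ) : Fin n × Option ℕ :=
  (p.bind (G.cross v)).elim (v, none) fun a => (a.1, some a.2)

/-- The node that is reached from `v` through port `p`. -/
def next (v : Fin n) (p : ℕ) : Fin n := (G.leave v (some p)).1

/-- The last node of the walk `l` from `v`. -/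
def dest (v : Fin n) : List Step → Fin n
  | [] => v
  | a :: l => dest (G.next v a.port) l

/-- The nodes of the walk `l` from `v` that are left by a step. -/
def sources (v : Fin n) : List Step → List (Fin n)
  | [] => []
  | a :: l => v :: sources (G.next v a.port) l

/-- All nodes of the walk `l` from `v`. -/
def nodes (v : Fin n) (l : List Step) : List (Fin n) := G.sources v l ++ [G.dest v l]

/-- The nodes that the walk `l` from `v` records as new, where `new` tells whether this includes the
start. -/
def discovered (v : Fin n) (new : Bool) : List Step → List (Fin n)
  | [] => if new then [v] else []
  | a :: l => (if new then [v] else []) ++ discovered (G.next v a.port) a.new l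

variable {G}

theorem cross_eq_some_iff {v w : Fin n} {p q : ℕ} :
    G.cross v p = some (w, q) ↔ ∃ h : G.graph.Adj v w,
      ((G.port v).symm ⟨w, h⟩ : ℕ) = p ∧ ((G.port w).symm ⟨v, h.symm⟩ : ℕ) = q := by
  constructor
  · unfold cross
    split_ifs with hp
    · simp only [Option.some.injEq, Prod.mk.injEq]
      rintro ⟨rfl, rfl⟩
      exact ⟨(G.port v ⟨p, hp⟩).2, by simp, rfl⟩
    · exact nofun
  · rintro ⟨h, rfl, rfl⟩
    obtain ⟨i, hi⟩ := (G.port v).surjective ⟨w, h⟩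
    rw [← hi, Equiv.symm_apply_apply]
    obtain rfl : (G.port v i : Fin n) = w := congrArg Subtype.val hi
    simp [cross]

theorem cross_symm {v w : Fin n} {p q : ℕ} (h : G.cross v p = some (w, q)) :
    G.cross w q = some (v, p) :=
  let ⟨hadj, hp, hq⟩ := cross_eq_some_iff.1 h
  cross_eq_some_iff.2 ⟨hadj.symm, hq, hp⟩

theorem exists_cross_eq_some {v : Fin n} {p : ℕ} (h : p < G.deg v) :
    ∃ w q, G.cross v p = some (w, q) :=
  ⟨_, _, dif_pos h⟩

theorem lt_deg_of_cross {v w : Fin n} {p q : ℕ} (h : G.cross v p = some (w, q)) :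
    p < G.deg v :=
  let ⟨_, hp, _⟩ := cross_eq_some_iff.1 h
  hp ▸ Fin.is_lt _

theorem leave_of_cross {v w : Fin n} {p q : ℕ} (h : G.cross v p = some (w, q)) :
    G.leave v (some p) = (w, some q) := by
  simp [leave, h]

theorem next_of_cross {v w : Fin n} {p q : ℕ} (h : G.cross v p = some (w, q)) :
    G.next v p = w :=
  congrArg Prod.fst (leave_of_cross h)

theorem exists_next_eq {v w : Fin n} (h : G.graph.Adj v w) : ∃ p < G.deg v, G.next v p = w :=
  ⟨_, Fin.is_lt _, next_of_cross (cross_eq_some_iff.2 ⟨h, rfl, rfl⟩)⟩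

variable (G) in
theorem deg_le (v : Fin n) : G.deg v ≤ n := by
  simpa using Fintype.card_le_of_injective (fun i => (G.port v i : Fin n))
    (Subtype.val_injective.comp (G.port v).injective)

theorem mem_of_closed {S : Set (Fin n)} {r : Fin n} (hr : r ∈ S)
    (hS : ∀ x ∈ S, ∀ p < G.deg x, G.next x p ∈ S) (v : Fin n) : v ∈ S := by
  obtain ⟨walk⟩ := G.connected.preconnected r v
  induction walk with
  | nil => exact hr
  | cons h _ ih =>
    obtain ⟨p, hp, rfl⟩ := exists_next_eq h
    exact ih (hS _ hr p hp)

theorem dest_append (v : Fin n) (l₁ l₂ : List Step) :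
    G.dest v (l₁ ++ l₂) = G.dest (G.dest v l₁) l₂ := by
  induction l₁ generalizing v with
  | nil => rfl
  | cons _ _ ih => exact ih _

theorem sources_append (v : Fin n) (l₁ l₂ : List Step) :
    G.sources v (l₁ ++ l₂) = G.sources v l₁ ++ G.sources (G.dest v l₁) l₂ := by
  induction l₁ generalizing v with
  | nil => rfl
  | cons _ _ ih => exact congrArg _ (ih _)

theorem start_mem_nodes (v : Fin n) (l : List Step) : v ∈ G.nodes v l := by
  cases l <;> simp [nodes, sources, dest]

theorem nodes_cons (v : Fin n) (a : Step) (l : List Step) :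
    G.nodes v (a :: l) = v :: G.nodes (G.next v a.port) l := rfl

theorem mem_nodes_iff {v x : Fin n} {l : List Step} :
    x ∈ G.nodes v l ↔ x ∈ G.sources v l ∨ x = G.dest v l := by
  simp [nodes]

theorem mem_nodes_append {v x : Fin n} {l₁ l₂ : List Step} :
    x ∈ G.nodes v (l₁ ++ l₂) ↔ x ∈ G.nodes v l₁ ∨ x ∈ G.nodes (G.dest v l₁) l₂ := by
  have hstart := G.start_mem_nodes (G.dest v l₁) l₂
  simp only [mem_nodes_iff, sources_append, dest_append, List.mem_append] at hstart ⊢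
  constructor
  · tauto
  · rintro ((h | rfl) | h) <;> tauto

theorem mem_nodes_rotate {v x : Fin n} {l₁ l₂ : List Step} (h : G.dest v (l₁ ++ l₂) = v) :
    x ∈ G.nodes (G.dest v l₁) (l₂ ++ l₁) ↔ x ∈ G.nodes v (l₁ ++ l₂) := by
  rw [mem_nodes_append, mem_nodes_append, ← dest_append, h, or_comm]

theorem mem_nodes_detour {v w x : Fin n} {l₁ l₂ : List Step} {a b : Step}
    (ha : G.next (G.dest v l₁) a.port = w) (hb : G.next w b.port = G.dest v l₁) :
    x ∈ G.nodes v (l₁ ++ a :: b :: l₂) ↔ x = w ∨ x ∈ G.nodes v (l₁ ++ l₂) := by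
  have hu : x = G.dest v l₁ → x ∈ G.nodes (G.dest v l₁) l₂ := fun h => h ▸ start_mem_nodes _ _
  simp only [mem_nodes_append, nodes_cons, ha, hb, List.mem_cons]
  tauto

theorem discovered_eq_append (v : Fin n) (new : Bool) (l : List Step) :
    G.discovered v new l = (if new then [v] else []) ++ G.discovered v false l := by
  cases l <;> simp [discovered]

theorem discovered_append (v : Fin n) (new : Bool) (l₁ l₂ : List Step) :
    G.discovered v new (l₁ ++ l₂) =
      G.discovered v new l₁ ++ G.discovered (G.dest v l₁) false l₂ := by
  induction l₁ generalizing v new with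
  | nil => exact discovered_eq_append v new l₂
  | cons a l ih => simp [discovered, dest, ih]

theorem discovered_detour_perm {v w : Fin n} {new : Bool} {l₁ l₂ : List Step} {p q : ℕ}
    (hp : G.next (G.dest v l₁) p = w) (hq : G.next w q = G.dest v l₁) :
    (G.discovered v new (l₁ ++ ⟨p, true⟩ :: ⟨q, false⟩ :: l₂)).Perm
      (w :: G.discovered v new (l₁ ++ l₂)) := by
  rw [discovered_append, discovered_append]
  simp [discovered, hp, hq]

theorem start_mem_discovered (v : Fin n) (l : List Step) : v ∈ G.discovered v true l := by
  simp [discovered_eq_append v true]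

theorem discovered_subset_nodes (v : Fin n) (new : Bool) (l : List Step) :
    G.discovered v new l ⊆ G.nodes v l := by
  have hstart (new : Bool) : (if new then [v] else []) ⊆ [v] := by cases new <;> simp
  induction l generalizing v new with
  | nil => exact hstart new
  | cons a l ih =>
    exact List.append_subset.2 ⟨fun x hx => List.mem_cons.2 (.inl (by simpa using hstart new hx)),
      List.subset_cons_of_subset _ (ih _ _ fun new => by cases new <;> simp)⟩

/-! ### Surveys -/

/-- A partial map of a graph: a closed walk, the part `done` of which has been surveyed, while at
the node where `todo` begins the ports below `port` have been surveyed. -/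
structure Survey where
  done : List Step
  todo : List Step
  port : ℕ
deriving DecidableEq

namespace Survey

/-- The closed walk of a survey. -/
def tour (S : Survey) : List Step := S.done ++ S.todo

/-- The survey after the present port has turned out to lead to a node of the tour. -/
def skip (S : Survey) : Survey := { S with port := S.port + 1 }

/-- The survey after the present port has turned out to lead to a new node, whose port `q` leads
back. -/
def detour (S : Survey) (q : ℕ) : Survey where
  done := S.done
  todo := ⟨S.port, true⟩ :: ⟨q, false⟩ :: S.todo
  port := S.port + 1

/-- A bound on the number of ports and steps to be surveyed in a graph with `n` nodes. -/
def remaining (n : ℕ) (S : Survey) : ℕ := (2 * n - 2 - S.done.length) * (n + 1) + (n - S.port)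

theorem tour_nil (l : List Step) (p : ℕ) : tour ⟨l, [], p⟩ = l := List.append_nil l

theorem remaining_advance_lt {l₁ l₂ : List Step} (hl : l₁.length < 2 * n - 2) (a : Step) (p : ℕ) :
    remaining n ⟨l₁ ++ [a], l₂, 0⟩ < remaining n ⟨l₁, a :: l₂, p⟩ := by
  obtain ⟨c, hc⟩ := Nat.exists_eq_add_of_lt hl
  have hbefore : 2 * n - 2 - l₁.length = c + 1 := by lia
  have hafter : 2 * n - 2 - (l₁.length + 1) = c := by lia
  simp only [remaining, List.length_append, List.length_singleton, hbefore, hafter]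
  lia

end Survey

variable (G) in
/-- `S` is a correct survey of `G` that begins at `r`: its tour is closed and discovers each of its
nodes exactly once, and the surveyed ports lead to nodes of the tour. -/
structure IsSurvey (r : Fin n) (S : Survey) : Prop where
  dest_tour : G.dest r S.tour = r
  nodup : (G.discovered r true S.tour).Nodup
  nodes_subset : G.nodes r S.tour ⊆ G.discovered r true S.tour
  length_tour : S.tour.length + 2 = 2 * (G.discovered r true S.tour).length
  closed : ∀ x ∈ G.sources r S.done, ∀ p < G.deg x, G.next x p ∈ G.discovered r true S.tour
  surveyed : ∀ p < S.port, p < G.deg (G.dest r S.done) →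
    G.next (G.dest r S.done) p ∈ G.discovered r true S.tour

namespace IsSurvey

variable {r : Fin n} {S : Survey}

theorem start (r : Fin n) : G.IsSurvey r ⟨[], [], 0⟩ where
  dest_tour := rfl
  nodup := by simp [Survey.tour, discovered]
  nodes_subset := by simp [Survey.tour, discovered, nodes, sources, dest]
  length_tour := by simp [Survey.tour, discovered]
  closed := by simp [sources]
  surveyed := by simp

theorem length_tour_le (h : G.IsSurvey r S) : S.tour.length + 2 ≤ 2 * n := by
  have hcard := h.nodup.length_le_card
  rw [Fintype.card_fin] at hcard
  rw [h.length_tour]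
  exact Nat.mul_le_mul_left 2 hcard

theorem skip (h : G.IsSurvey r S) (hS : G.next (G.dest r S.done) S.port ∈ G.nodes r S.tour) :
    G.IsSurvey r S.skip :=
  { h with
    surveyed := fun p hp hdeg => by
      rcases Nat.lt_succ_iff_lt_or_eq.1 hp with hp | rfl
      · exact h.surveyed p hp hdeg
      · exact h.nodes_subset hS }

theorem detour (h : G.IsSurvey r S) {w : Fin n} {q : ℕ}
    (hw : G.cross (G.dest r S.done) S.port = some (w, q)) (hnew : w ∉ G.nodes r S.tour) :
    G.IsSurvey r (S.detour q) := by
  have hout : G.next (G.dest r S.done) S.port = w := next_of_cross hw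
  have hback : G.next w q = G.dest r S.done := next_of_cross (cross_symm hw)
  have hperm : (G.discovered r true (S.detour q).tour).Perm (w :: G.discovered r true S.tour) :=
    discovered_detour_perm hout hback
  have hold {x : Fin n} (hx : x ∈ G.discovered r true S.tour) :
      x ∈ G.discovered r true (S.detour q).tour :=
    hperm.mem_iff.2 (List.mem_cons_of_mem _ hx)
  have hw_mem : w ∈ G.discovered r true (S.detour q).tour := hperm.mem_iff.2 List.mem_cons_self
  refine ⟨?_, ?_, fun x hx => ?_, ?_, fun x hx p hp => hold (h.closed x hx p hp),
    fun p hp hdeg => ?_⟩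
  · have hdest := h.dest_tour
    rw [Survey.tour, dest_append] at hdest ⊢
    simpa only [Survey.detour, dest, hout, hback] using hdest
  · exact hperm.nodup_iff.2
      (List.nodup_cons.2 ⟨fun hx => hnew (discovered_subset_nodes _ _ _ hx), h.nodup⟩)
  · rcases (mem_nodes_detour hout hback).1 hx with rfl | hx
    · exact hw_mem
    · exact hold (h.nodes_subset hx)
  · have hlength := h.length_tour
    rw [hperm.length_eq, List.length_cons]
    simp only [Survey.tour, Survey.detour, List.length_append, List.length_cons] at hlength ⊢
    lia
  · rcases Nat.lt_succ_iff_lt_or_eq.1 hp with hp | rfl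
    · exact hold (h.surveyed p hp hdeg)
    · exact hout ▸ hw_mem

theorem advance {l₁ l₂ : List Step} {a : Step} {p : ℕ} (h : G.IsSurvey r ⟨l₁, a :: l₂, p⟩)
    (hp : G.deg (G.dest r l₁) ≤ p) : G.IsSurvey r ⟨l₁ ++ [a], l₂, 0⟩ := by
  have htour : Survey.tour ⟨l₁ ++ [a], l₂, 0⟩ = Survey.tour ⟨l₁, a :: l₂, p⟩ :=
    List.append_cons _ _ _ |>.symm
  refine ⟨htour ▸ h.dest_tour, htour ▸ h.nodup, htour ▸ h.nodes_subset, htour ▸ h.length_tour,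
    fun x hx j hj => ?_, fun j hj => absurd hj (Nat.not_lt_zero j)⟩
  rw [htour]
  simp only [sources_append, sources, List.mem_append, List.mem_singleton] at hx
  rcases hx with hx | rfl
  · exact h.closed x hx j hj
  · exact h.surveyed j (hj.trans_le hp) hj

section Complete

variable {l : List Step} {p : ℕ} (h : G.IsSurvey r ⟨l, [], p⟩)
include h

theorem dest_done : G.dest r l = r := by simpa only [Survey.tour_nil] using h.dest_tour

theorem mem_sources_or_eq {x : Fin n} (hx : x ∈ G.discovered r true l) :
    x ∈ G.sources r l ∨ x = r := by
  have hnodes := mem_nodes_iff.1 (discovered_subset_nodes _ _ _ hx)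
  rwa [h.dest_done] at hnodes

theorem mem_discovered (hp : G.deg r ≤ p) (v : Fin n) : v ∈ G.discovered r true l := by
  have hclosed := h.closed
  have hsurveyed := h.surveyed
  simp only [Survey.tour_nil, h.dest_done] at hclosed hsurveyed
  refine mem_of_closed (G := G) (S := {x | x ∈ G.discovered r true l})
    (start_mem_discovered r l) (fun x hx j hj => ?_) v
  rcases h.mem_sources_or_eq hx with hx | rfl
  · exact hclosed x hx j hj
  · exact hsurveyed j (hj.trans_le hp) hj

theorem sum_map_discovered (hp : G.deg r ≤ p) (c : Fin n → ℕ) :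
    ((G.discovered r true l).map c).sum = ∑ v, c v := by
  have hnodup := h.nodup
  rw [Survey.tour_nil] at hnodup
  rw [← List.sum_toFinset c hnodup]
  congr 1
  exact Finset.eq_univ_iff_forall.2 fun v => List.mem_toFinset.2 (h.mem_discovered hp v)

end Complete

end IsSurvey

end PortGraph

/-! ### Walks along exploration sequences -/

/-- The port through which a robot that follows the integer `x` leaves a node of degree `d` which it
has entered through port `p`. -/
def uxsPort (d p : ℕ) (x : ℤ) : ℕ := ((p + x) % d).toNat

namespace PortGraph

variable {n : ℕ} (G : PortGraph n)

theorem length_visits (x : List ℤ) (a : Fin n × ℕ) : (G.visits x a).length = x.length + 1 := by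
  induction x generalizing a with
  | nil => rfl
  | cons _ _ ih => simp [visits, ih]

theorem fst_leave_getD_snd_leave (v : Fin n) (p : ℕ) :
    ((G.leave v (some p)).1, (G.leave v (some p)).2.getD 0) = (G.cross v p).getD (v, 0) := by
  simp only [leave, Option.bind_some]
  cases G.cross v p <;> rfl

variable {G} in
theorem exists_eq_of_mem_visits {v : Fin n} {x : List ℤ} {b : ℕ → Fin n × ℕ}
    (hb : ∀ s < x.length, b (s + 1) =
      (G.cross (b s).1 (uxsPort (G.deg (b s).1) (b s).2 (x.getD s 0))).getD ((b s).1, 0))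
    (hv : v ∈ G.visits x (b 0)) : ∃ s ≤ x.length, (b s).1 = v := by
  induction x generalizing b with
  | nil => exact ⟨0, le_rfl, (List.mem_singleton.1 hv).symm⟩
  | cons z x ih =>
    rcases List.mem_cons.1 hv with rfl | hv
    · exact ⟨0, Nat.zero_le _, rfl⟩
    · have hfirst : b 1 = _ := hb 0 (by simp)
      obtain ⟨s, hs, hsv⟩ := ih (b := fun s => b (s + 1))
        (fun s hs => hb (s + 1) (Nat.succ_lt_succ hs)) (by rw [hfirst]; exact hv)
      exact ⟨s + 1, Nat.succ_le_succ hs, hsv⟩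

theorem nonempty_of_pos {n : ℕ} (hn : 0 < n) : Nonempty (PortGraph n) := by
  classical
  have : Nonempty (Fin n) := ⟨⟨0, hn⟩⟩
  exact ⟨⟨⊤, SimpleGraph.connected_top,
    fun v => Fintype.card ((⊤ : SimpleGraph (Fin n)).neighborSet v),
    fun v => (Fintype.equivFin _).symm⟩⟩

end PortGraph

theorem IsUXS.mono {m n : ℕ} {x : List ℤ} (h : IsUXS n x) (hmn : m ≤ n) : IsUXS m x :=
  fun l hl => h l (hl.trans hmn)

theorem IsUXS.le_uxsRounds {n : ℕ} {x : List ℤ} (h : IsUXS n x) : n ≤ uxsRounds x + 1 := by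
  rcases Nat.eq_zero_or_pos n with rfl | hn
  · exact Nat.zero_le _
  obtain ⟨G⟩ := PortGraph.nonempty_of_pos hn
  have hvisits : (Finset.univ : Finset (Fin n)) ⊆ (G.visits (0 :: x) (⟨0, hn⟩, 0)).toFinset :=
    fun v _ => List.mem_toFinset.2 (h n le_rfl G _ v)
  simpa [G.length_visits, uxsRounds] using
    (Finset.card_le_card hvisits).trans (List.toFinset_card_le _)

theorem exists_isUXS_of_uxsRounds_le (b : ℕ) :
    ∃ x, ∀ n y, IsUXS n y → uxsRounds y ≤ b → IsUXS n x ∧ uxsRounds x ≤ b := by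
  classical
  by_cases hb : ∃ n y, IsUXS n y ∧ uxsRounds y ≤ b
  · have hbound {n : ℕ} (hn : ∃ y, IsUXS n y ∧ uxsRounds y ≤ b) : n ≤ b + 1 :=
      let ⟨_, hy, hyb⟩ := hn
      hy.le_uxsRounds.trans (Nat.succ_le_succ hyb)
    obtain ⟨n₀, hn₀⟩ := hb
    obtain ⟨x, hx, hxb⟩ := Nat.findGreatest_spec
      (P := fun n => ∃ y, IsUXS n y ∧ uxsRounds y ≤ b) (hbound hn₀) hn₀
    exact ⟨x, fun n y hy hyb =>
      ⟨hx.mono (Nat.le_findGreatest (hbound ⟨y, hy, hyb⟩) ⟨y, hy, hyb⟩), hxb⟩⟩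
  · exact ⟨[], fun n y hy hyb => absurd ⟨n, y, hy, hyb⟩ hb⟩

/-! ### The algorithm -/

namespace Herding

open PortGraph (Step Survey)

/-- The messages: a report whether the robot has joined the herd, or an order of the shepherd, on
which the robots with the listed IDs terminate and the others join the herd and leave through the
given port (`none`: stay). Orders are obeyed only if they come from the shepherd. -/
inductive Message where
  | report (joined : Bool)
  | order (settlers : List ℕ) (port : Option ℕ)
deriving DecidableEq

/-- The memory of the shepherd. It gathers a herd, where `c` counts the rounds from `1`. Then it
surveys the graph: to `explore` a port it leads the herd through this port, leaves it there to go
`away`, makes a `scan` of the tour for it, where the herd is entered through port `q` and `rest` is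
the part of the tour to be scanned, and leads it `back`. Finally it leads the herd along a tour and
lets the listed robots `settle`; `new` tells whether the present node is met for the first time. -/
inductive Phase where
  | gather (k f c : ℕ)
  | explore (f : ℕ) (S : Survey)
  | away (f : ℕ) (S : Survey)
  | scan (f : ℕ) (S : Survey) (q : ℕ) (rest : List Step) (found : Bool)
  | back (f : ℕ) (S : Survey) (q : ℕ) (found : Bool)
  | settle (labels : List ℕ) (rest : List Step) (new : Bool)
deriving DecidableEq

/-- The memory of a robot. -/
inductive Memory where
  | follower (id : ℕ) (joined : Bool)
  | shepherd (φ : Phase)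
deriving DecidableEq

/-- The port used in round `c` of the gathering, counted from `1`: the walk along `W j` takes up the
rounds from `2 ^ j` to `2 ^ (j + 1) - 1`. -/
def gatherPort (W : ℕ → List ℤ) (c : ℕ) (ν : LocalView) : ℕ :=
  let j := Nat.log 2 c
  let s := c - 2 ^ j
  uxsPort ν.degree (if s = 0 then 0 else ν.entry.getD 0) ((0 :: W j).getD s 0)

/-- The number of robots that the shepherd lets settle at a node. -/
def quota (new : Bool) (capacity : ℕ) : ℕ := if new then capacity else 0

/-- Whether more than `f` of the sighted robots report that they have joined the herd. -/
def herdHere (f : ℕ) (H : Multiset (Sighting Message)) : Bool :=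
  f < H.countP fun s => s.msg = some (.report true)

namespace Phase

/-- The port through which the shepherd is going to leave. -/
def port (W : ℕ → List ℤ) : Phase → LocalView → Option ℕ
  | gather _ _ c, ν => some (gatherPort W c ν)
  | explore _ S, ν => if S.port < ν.degree then some S.port else S.todo.head?.map Step.port
  | away _ _, ν => ν.entry
  | scan _ S _ rest _, _ => some (rest.head?.elim S.port Step.port)
  | back _ _ q _, _ => some q
  | settle _ rest _, _ => rest.head?.map Step.port

/-- The message of the shepherd. -/
def shout (W : ℕ → List ℤ) : Phase → LocalView → Message
  | away _ _, _ => .report false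
  | scan _ _ _ _ _, _ => .report false
  | settle L rest new, ν => .order (L.take (quota new ν.capacity)) ((settle L rest new).port W ν)
  | φ, ν => .order [] (φ.port W ν)

/-- The next phase of the shepherd. -/
noncomputable def update : Phase → LocalView → Multiset (Sighting Message) → Phase
  | gather k f c, _, H => if k ≤ H.card + f + 1 then explore f ⟨[], [], 0⟩ else gather k f (c + 1)
  | explore f S, ν, H =>
      if S.port < ν.degree then away f S
      else match S.todo with
        | [] => settle (H.map Sighting.label).toList S.tour true
        | a :: l => explore f ⟨S.done ++ [a], l, 0⟩
  | away f S, ν, _ => scan f S (ν.entry.getD 0) (S.todo ++ S.done) false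
  | scan f S q (_ :: rest) found, _, H => scan f S q rest (found || herdHere f H)
  | scan f S q [] found, _, H => back f S q (found || herdHere f H)
  | back f S q found, _, _ => explore f (if found then S.skip else S.detour q)
  | settle L rest new, ν, _ =>
      settle (L.drop (quota new ν.capacity)) rest.tail (rest.head?.elim false Step.new)

/-- Whether the shepherd terminates: it does so at a node that has room for itself and for all the
robots which are still to settle. -/
def halts : Phase → LocalView → Bool
  | settle L _ new, ν => L.length < quota new ν.capacity
  | _, _ => false

end Phase

/-- The message of the shepherd, if it is sighted. -/
noncomputable def shepherdMsg (H : Multiset (Sighting Message)) : Option Message :=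
  (H.toList.find? Sighting.isShepherd).bind Sighting.msg

/-- The decision of a follower that hears the given message of the shepherd. -/
def obey (id : ℕ) (joined : Bool) : Option Message → Decision Memory
  | some (.order settlers port) =>
      if id ∈ settlers then .terminate else .go (.follower id true) port
  | _ => .go (.follower id joined) none

/-- The message of a robot. -/
def Memory.shout (W : ℕ → List ℤ) : Memory → LocalView → Message
  | follower _ joined, _ => .report joined
  | shepherd φ, ν => φ.shout W ν

/-- The decision of a robot. -/
noncomputable def Memory.step (W : ℕ → List ℤ) :
    Memory → LocalView → Multiset (Sighting Message) → Decision Memory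
  | follower id joined, _, H => obey id joined (shepherdMsg H)
  | shepherd φ, ν, H =>
      if φ.halts ν then .terminate else .go (.shepherd (φ.update ν H)) (φ.port W ν)

/-- The algorithm that gathers the herd along the sequences `W j`. -/
noncomputable abbrev algorithm (W : ℕ → List ℤ) : Algorithm where
  Msg := Message
  State := Memory
  initShepherd k f _ := .shepherd (.gather k f 1)
  initOther id := .follower id false
  shout := Memory.shout W
  step := Memory.step W

end Herding

/-! ### Single rounds -/

namespace Trace

variable {n k f t : ℕ} {I : Instance n k} {A : Algorithm} {τ : Trace n k A} {i : Fin k}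

theorem outcome_go {S : Type} (G : PortGraph n) (v : Fin n) (s : S) (p : Option ℕ) :
    outcome G v (.go s p) = (some s, G.leave v p) := by
  cases p with
  | none => rfl
  | some p =>
    simp only [outcome, PortGraph.leave, Option.bind_some]
    cases G.cross v p <;> rfl

theorem IsExecution.succ_of_go (hτ : τ.IsExecution I f) (hi : i ∉ I.byz) {s s' : A.State}
    {p : Option ℕ} (hs : τ.state t i = some s)
    (hstep : A.step s (τ.view I t i) (τ.heard I t i) = .go s' p) :
    τ.state (t + 1) i = some s' ∧
      (τ.pos (t + 1) i, τ.entry (t + 1) i) = I.G.leave (τ.pos t i) p := by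
  simpa only [Trace.next, hs, hstep, outcome_go, Prod.mk.injEq] using
    Prod.ext_iff.1 (hτ.follow t i hi)

theorem IsExecution.succ_of_terminate (hτ : τ.IsExecution I f) (hi : i ∉ I.byz) {s : A.State}
    (hs : τ.state t i = some s)
    (hstep : A.step s (τ.view I t i) (τ.heard I t i) = .terminate) :
    τ.state (t + 1) i = none ∧ τ.pos (t + 1) i = τ.pos t i := by
  have h := hτ.follow t i hi
  simp only [Trace.next, hs, hstep, outcome, Prod.mk.injEq] at h
  exact ⟨h.1, h.2.1⟩

theorem IsExecution.succ_of_terminated (hτ : τ.IsExecution I f) (hi : i ∉ I.byz)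
    (hs : τ.state t i = none) : τ.state (t + 1) i = none ∧ τ.pos (t + 1) i = τ.pos t i := by
  have h := hτ.follow t i hi
  simp only [Trace.next, hs, Prod.mk.injEq] at h
  exact ⟨h.1, h.2.1⟩

end Trace

namespace Herding

open PortGraph (Step Survey)

variable {n k f : ℕ} {I : Instance n k} {W : ℕ → List ℤ} {τ : Trace n k (algorithm W)}

/-- The view of a robot whose node and entry port are given by `a`. -/
def localView (I : Instance n k) (a : Fin n × Option ℕ) : LocalView :=
  ⟨I.G.deg a.1, I.cap a.1, a.2⟩

/-- At time `t` the shepherd is in phase `φ`, and its node and entry port are given by `a`. -/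
def ShepherdAt (I : Instance n k) (τ : Trace n k (algorithm W)) (t : ℕ) (φ : Phase)
    (a : Fin n × Option ℕ) : Prop :=
  τ.state t I.shepherd = some (.shepherd φ) ∧ (τ.pos t I.shepherd, τ.entry t I.shepherd) = a

/-- The non-Byzantine robots other than the shepherd. -/
def followers (I : Instance n k) : Finset (Fin k) := I.byzᶜ.erase I.shepherd

theorem mem_followers {i : Fin k} : i ∈ followers I ↔ i ∉ I.byz ∧ i ≠ I.shepherd := by
  simp [followers, and_comm]

theorem shepherdMsg_heard {t : ℕ} {i : Fin k} (hi : i ≠ I.shepherd) :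
    shepherdMsg (τ.heard I t i) =
      if τ.pos t i = τ.pos t I.shepherd then τ.msg t I.shepherd else none := by
  have hmem {s : Sighting Message} : s ∈ τ.heard I t i ∧ s.isShepherd ↔
      τ.pos t i = τ.pos t I.shepherd ∧
        s = ⟨τ.label t I.shepherd, true, τ.msg t I.shepherd⟩ := by
    simp only [Trace.heard, Multiset.mem_map, Finset.mem_val, Finset.mem_filter, Finset.mem_univ,
      true_and]
    constructor
    · rintro ⟨⟨j, ⟨-, hj⟩, rfl⟩, hshepherd⟩
      obtain rfl : j = I.shepherd := by simpa using hshepherd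
      exact ⟨hj.symm, by simp⟩
    · rintro ⟨hpos, rfl⟩
      exact ⟨⟨I.shepherd, ⟨hi.symm, hpos.symm⟩, by simp⟩, rfl⟩
  rw [shepherdMsg]
  split_ifs with hpos
  · cases hfind : (τ.heard I t i).toList.find? Sighting.isShepherd with
    | none =>
      have hnone := List.find?_eq_none.1 hfind ⟨_, true, _⟩
        (Multiset.mem_toList.2 (hmem.2 ⟨hpos, rfl⟩).1)
      simp at hnone
    | some s =>
      have hs := hmem.1 ⟨Multiset.mem_toList.1 (List.mem_of_find?_eq_some hfind),
        List.find?_some hfind⟩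
      rw [hs.2, Option.bind_some]
  · rw [List.find?_eq_none.2 fun s hs hshepherd =>
      hpos (hmem.1 ⟨Multiset.mem_toList.1 hs, hshepherd⟩).1, Option.bind_none]

namespace ShepherdAt

variable {t : ℕ} {φ : Phase} {a : Fin n × Option ℕ}

theorem pos (h : ShepherdAt I τ t φ a) : τ.pos t I.shepherd = a.1 := congrArg Prod.fst h.2

theorem view (h : ShepherdAt I τ t φ a) : τ.view I t I.shepherd = localView I a := by
  rw [← h.2]
  rfl

theorem msg (h : ShepherdAt I τ t φ a) (hI : I.Valid f) (hτ : τ.IsExecution I f) :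
    τ.msg t I.shepherd = some (φ.shout W (localView I a)) := by
  rw [hτ.msg_eq t _ hI.shepherd_honest, h.1, h.view]
  rfl

theorem succ (h : ShepherdAt I τ t φ a) (hI : I.Valid f) (hτ : τ.IsExecution I f)
    (hφ : φ.halts (localView I a) = false) :
    ShepherdAt I τ (t + 1) (φ.update (localView I a) (τ.heard I t I.shepherd))
      (I.G.leave a.1 (φ.port W (localView I a))) := by
  have hstep : Memory.step W (.shepherd φ) (localView I a) (τ.heard I t I.shepherd) =
      .go (.shepherd (φ.update (localView I a) (τ.heard I t I.shepherd)))
        (φ.port W (localView I a)) := by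
    simp [Memory.step, hφ]
  rw [← h.pos]
  exact hτ.succ_of_go hI.shepherd_honest h.1 (h.view ▸ hstep)

theorem succ_of_halts (h : ShepherdAt I τ t φ a) (hI : I.Valid f) (hτ : τ.IsExecution I f)
    (hφ : φ.halts (localView I a) = true) :
    τ.state (t + 1) I.shepherd = none ∧ τ.pos (t + 1) I.shepherd = a.1 := by
  have hstep : Memory.step W (.shepherd φ) (localView I a) (τ.heard I t I.shepherd) =
      .terminate := by
    simp [Memory.step, hφ]
  rw [← h.pos]
  exact hτ.succ_of_terminate hI.shepherd_honest h.1 (h.view ▸ hstep)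

end ShepherdAt

section Followers

variable {t : ℕ} {i : Fin k} {b : Bool}

theorem follower_wait (hτ : τ.IsExecution I f) (hi : i ∈ followers I)
    (hstate : τ.state t i = some (.follower (I.id i) b))
    (hmsg : τ.pos t i = τ.pos t I.shepherd → ∃ b', τ.msg t I.shepherd = some (.report b')) :
    τ.state (t + 1) i = some (.follower (I.id i) b) ∧ τ.pos (t + 1) i = τ.pos t i := by
  obtain ⟨hbyz, hne⟩ := mem_followers.1 hi
  have hobey : obey (I.id i) b (shepherdMsg (τ.heard I t i)) =
      .go (.follower (I.id i) b) none := by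
    rw [shepherdMsg_heard hne]
    split_ifs with hpos
    · obtain ⟨b', hb'⟩ := hmsg hpos
      rw [hb']
      rfl
    · rfl
  obtain ⟨hstate', hleave⟩ := hτ.succ_of_go hbyz hstate hobey
  exact ⟨hstate', congrArg Prod.fst hleave⟩

variable {L : List ℕ} {p : Option ℕ}

theorem follower_join (hτ : τ.IsExecution I f) (hi : i ∈ followers I)
    (hstate : τ.state t i = some (.follower (I.id i) b)) (hpos : τ.pos t i = τ.pos t I.shepherd)
    (hmsg : τ.msg t I.shepherd = some (.order L p)) (hL : I.id i ∉ L) :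
    τ.state (t + 1) i = some (.follower (I.id i) true) ∧
      τ.pos (t + 1) i = (I.G.leave (τ.pos t i) p).1 := by
  obtain ⟨hbyz, hne⟩ := mem_followers.1 hi
  have hobey : obey (I.id i) b (shepherdMsg (τ.heard I t i)) = .go (.follower (I.id i) true) p := by
    rw [shepherdMsg_heard hne, if_pos hpos, hmsg]
    exact if_neg hL
  obtain ⟨hstate', hleave⟩ := hτ.succ_of_go hbyz hstate hobey
  exact ⟨hstate', congrArg Prod.fst hleave⟩

theorem follower_settle (hτ : τ.IsExecution I f) (hi : i ∈ followers I)
    (hstate : τ.state t i = some (.follower (I.id i) b)) (hpos : τ.pos t i = τ.pos t I.shepherd)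
    (hmsg : τ.msg t I.shepherd = some (.order L p)) (hL : I.id i ∈ L) :
    τ.state (t + 1) i = none ∧ τ.pos (t + 1) i = τ.pos t i := by
  obtain ⟨hbyz, hne⟩ := mem_followers.1 hi
  have hobey : obey (I.id i) b (shepherdMsg (τ.heard I t i)) = .terminate := by
    rw [shepherdMsg_heard hne, if_pos hpos, hmsg]
    exact if_pos hL
  exact hτ.succ_of_terminate hbyz hstate hobey

end Followers

/-! ### The herd -/

/-- The followers that have joined the herd at time `t`. -/
def joined (I : Instance n k) (τ : Trace n k (algorithm W)) (t : ℕ) : Finset (Fin k) :=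
  {i ∈ followers I | τ.state t i = some (.follower (I.id i) true)}

theorem mem_joined {t : ℕ} {i : Fin k} : i ∈ joined I τ t ↔
    i ∈ followers I ∧ τ.state t i = some (.follower (I.id i) true) :=
  Finset.mem_filter

/-- At time `t` a herd of at least `m` followers is at `u`, while the other followers are still
where they started, outside `D`. -/
structure Herd (I : Instance n k) (τ : Trace n k (algorithm W)) (t : ℕ) (u : Fin n)
    (D : Set (Fin n)) (m : ℕ) : Prop where
  whereabouts : ∀ i ∈ followers I,
    (τ.state t i = some (.follower (I.id i) true) ∧ τ.pos t i = u) ∨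
    (τ.state t i = some (.follower (I.id i) false) ∧ τ.pos t i = I.start i ∧ I.start i ∉ D)
  size : m ≤ (joined I τ t).card

namespace Herd

variable {t m : ℕ} {u : Fin n} {D : Set (Fin n)} {φ : Phase} {a : Fin n × Option ℕ} {i : Fin k}

theorem mono (h : Herd I τ t u D m) {E : Set (Fin n)} (hE : E ⊆ D) : Herd I τ t u E m where
  whereabouts i hi := (h.whereabouts i hi).imp_right fun h => ⟨h.1, h.2.1, fun h' => h.2.2 (hE h')⟩
  size := h.size

theorem exists_state (h : Herd I τ t u D m) (hi : i ∈ followers I) :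
    ∃ b, τ.state t i = some (.follower (I.id i) b) :=
  (h.whereabouts i hi).elim (fun h => ⟨_, h.1⟩) (fun h => ⟨_, h.1⟩)

theorem pos_of_mem_joined (h : Herd I τ t u D m) (hi : i ∈ joined I τ t) : τ.pos t i = u := by
  obtain ⟨hi, hstate⟩ := mem_joined.1 hi
  refine (h.whereabouts i hi).elim And.right fun h => ?_
  simp [hstate] at h

section Moves

variable (hI : I.Valid f) (hτ : τ.IsExecution I f)
include hI hτ

theorem wait (h : Herd I τ t u D m) (hs : ShepherdAt I τ t φ a) {b : Bool}
    (hφ : φ.shout W (localView I a) = .report b) : Herd I τ (t + 1) u D m := by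
  have hmsg := hs.msg hI hτ
  rw [hφ] at hmsg
  have hwait {i : Fin k} {b' : Bool} (hi : i ∈ followers I)
      (hstate : τ.state t i = some (.follower (I.id i) b')) :=
    follower_wait hτ hi hstate fun _ => ⟨b, hmsg⟩
  constructor
  · intro i hi
    rcases h.whereabouts i hi with ⟨hstate, hpos⟩ | ⟨hstate, hpos, hD⟩
    · exact .inl ⟨(hwait hi hstate).1, (hwait hi hstate).2.trans hpos⟩
    · exact .inr ⟨(hwait hi hstate).1, (hwait hi hstate).2.trans hpos, hD⟩
  · refine h.size.trans (Finset.card_le_card fun i hi => ?_)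
    obtain ⟨hi, hstate⟩ := mem_joined.1 hi
    exact mem_joined.2 ⟨hi, (hwait hi hstate).1⟩

theorem join (h : Herd I τ t a.1 D m) (hs : ShepherdAt I τ t φ a) {p : Option ℕ}
    (hφ : φ.shout W (localView I a) = .order [] p) (hi : i ∈ followers I)
    (hpos : τ.pos t i = a.1) :
    i ∈ joined I τ (t + 1) ∧ τ.pos (t + 1) i = (I.G.leave a.1 p).1 := by
  obtain ⟨b, hstate⟩ := h.exists_state hi
  have hmsg := hs.msg hI hτ
  rw [hφ] at hmsg
  obtain ⟨hstate', hpos'⟩ :=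
    follower_join hτ hi hstate (hpos.trans hs.pos.symm) hmsg List.not_mem_nil
  exact ⟨mem_joined.2 ⟨hi, hstate'⟩, hpos ▸ hpos'⟩

theorem lead (h : Herd I τ t a.1 D m) (hs : ShepherdAt I τ t φ a) {p : Option ℕ}
    (hφ : φ.shout W (localView I a) = .order [] p) :
    Herd I τ (t + 1) (I.G.leave a.1 p).1 (insert a.1 D) m := by
  constructor
  · intro i hi
    by_cases hpos : τ.pos t i = a.1
    · obtain ⟨hjoined, hpos'⟩ := h.join hI hτ hs hφ hi hpos
      exact .inl ⟨(mem_joined.1 hjoined).2, hpos'⟩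
    · rcases h.whereabouts i hi with ⟨-, hpos'⟩ | ⟨hstate, hstart, hD⟩
      · exact absurd hpos' hpos
      · obtain ⟨hstate', hpos'⟩ := follower_wait hτ hi hstate
          fun hsame => absurd (hsame.trans hs.pos) hpos
        refine .inr ⟨hstate', hpos'.trans hstart, ?_⟩
        rintro (hmem | hmem)
        · exact hpos (hstart.trans hmem)
        · exact hD hmem
  · refine h.size.trans (Finset.card_le_card fun i hi => ?_)
    exact (h.join hI hτ hs hφ (mem_joined.1 hi).1 (h.pos_of_mem_joined hi)).1

end Moves

end Herd

theorem card_heard (t : ℕ) (i : Fin k) : (τ.heard I t i).card =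
    (Finset.univ.filter fun j => j ≠ i ∧ τ.pos t j = τ.pos t i).card :=
  Multiset.card_map _ _

/-- The robots at the node of the shepherd that report that they have joined the herd. -/
def reporters (I : Instance n k) (τ : Trace n k (algorithm W)) (t : ℕ) : Finset (Fin k) :=
  {j | (j ≠ I.shepherd ∧ τ.pos t j = τ.pos t I.shepherd) ∧ τ.msg t j = some (.report true)}

theorem herdHere_heard (f t : ℕ) :
    herdHere f (τ.heard I t I.shepherd) = true ↔ f < (reporters I τ t).card := by
  have hcount : (τ.heard I t I.shepherd).countP (fun s => s.msg = some (Message.report true)) =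
      (reporters I τ t).card := by
    rw [Trace.heard, Multiset.countP_map, reporters,
      ← Finset.filter_filter (fun j => j ≠ I.shepherd ∧ τ.pos t j = τ.pos t I.shepherd)]
    rfl
  rw [herdHere, decide_eq_true_iff, hcount]

section Recognition

variable (hτ : τ.IsExecution I f) {t m : ℕ} {u : Fin n} {D : Set (Fin n)}
include hτ

theorem follower_msg {i : Fin k} {b : Bool} (hi : i ∈ followers I)
    (hstate : τ.state t i = some (.follower (I.id i) b)) : τ.msg t i = some (.report b) := by
  rw [hτ.msg_eq t i (mem_followers.1 hi).1, hstate]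
  rfl

theorem Herd.joined_subset_reporters (h : Herd I τ t u D m) (hu : τ.pos t I.shepherd = u) :
    joined I τ t ⊆ reporters I τ t := fun i hi => by
  have hpos := h.pos_of_mem_joined hi
  obtain ⟨hi, hstate⟩ := mem_joined.1 hi
  simp only [reporters, Finset.mem_filter_univ]
  exact ⟨⟨(mem_followers.1 hi).2, hpos.trans hu.symm⟩, follower_msg hτ hi hstate⟩

theorem Herd.reporters_subset_byz (h : Herd I τ t u D m) (hu : τ.pos t I.shepherd ≠ u) :
    reporters I τ t ⊆ I.byz := fun i hi => by
  simp only [reporters, Finset.mem_filter_univ] at hi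
  obtain ⟨⟨hne, hpos⟩, hmsg⟩ := hi
  by_contra hbyz
  have hfollower : i ∈ followers I := mem_followers.2 ⟨hbyz, hne⟩
  rcases h.whereabouts i hfollower with ⟨-, hpos'⟩ | ⟨hstate, -⟩
  · exact hu (hpos.symm.trans hpos')
  · simp [follower_msg hτ hfollower hstate] at hmsg

theorem Herd.herdHere_iff (hI : I.Valid f) (h : Herd I τ t u D (f + 1)) {φ : Phase}
    {a : Fin n × Option ℕ} (hs : ShepherdAt I τ t φ a) :
    herdHere f (τ.heard I t I.shepherd) = true ↔ u = a.1 := by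
  rw [herdHere_heard, ← hs.pos, eq_comm (a := u)]
  refine ⟨fun hf => ?_, fun hu =>
    h.size.trans (Finset.card_le_card (h.joined_subset_reporters hτ hu))⟩
  by_contra hu
  exact absurd ((Finset.card_le_card (h.reporters_subset_byz hτ hu)).trans hI.card_byz) hf.not_ge

end Recognition

/-! ### Settlement -/

/-- The followers that have terminated at `x` by time `t`. -/
def settledAt (I : Instance n k) (τ : Trace n k (algorithm W)) (t : ℕ) (x : Fin n) :
    Finset (Fin k) :=
  {i ∈ followers I | τ.state t i = none ∧ τ.pos t i = x}

theorem mem_settledAt {t : ℕ} {x : Fin n} {i : Fin k} : i ∈ settledAt I τ t x ↔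
    i ∈ followers I ∧ τ.state t i = none ∧ τ.pos t i = x :=
  Finset.mem_filter

theorem card_le_of_id_mem (hI : I.Valid f) {F : Finset (Fin k)} {L : List ℕ}
    (h : ∀ i ∈ F, I.id i ∈ L) : F.card ≤ L.length :=
  (Finset.card_le_card_of_injOn (t := L.toFinset) I.id (fun i hi => List.mem_toFinset.2 (h i hi))
    hI.id_injective.injOn).trans (List.toFinset_card_le L)

/-- The followers that are still to settle are led along the rest `T` of the tour and are among
those with labels in `L`. The nodes that `T` discovers are free and have room for all of them. -/
structure Settling (I : Instance n k) (τ : Trace n k (algorithm W)) (t : ℕ) (v : Fin n)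
    (L : List ℕ) (T : List Step) (new : Bool) : Prop where
  shepherd : ∃ e, ShepherdAt I τ t (.settle L T new) (v, e)
  whereabouts : ∀ i ∈ followers I,
    (τ.state t i = some (.follower (I.id i) true) ∧ τ.pos t i = v ∧ I.id i ∈ L) ∨
    (τ.state t i = none ∧ τ.pos t i ∉ I.G.discovered v new T)
  card_settledAt_le : ∀ x, (settledAt I τ t x).card ≤ I.cap x
  nodup : (I.G.discovered v new T).Nodup
  room : L.length < ((I.G.discovered v new T).map I.cap).sum

namespace Settling

variable {t : ℕ} {v : Fin n} {L : List ℕ} {T : List Step} {new : Bool} {i : Fin k}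

theorem room_cons {a : Step} (h : Settling I τ t v L (a :: T) new) :
    L.length < quota new (I.cap v) +
      ((I.G.discovered (I.G.next v a.port) a.new T).map I.cap).sum := by
  have hroom := h.room
  cases new <;> simpa [PortGraph.discovered, quota] using hroom

theorem room_nil (h : Settling I τ t v L [] new) : L.length < quota new (I.cap v) := by
  have hroom := h.room
  cases new
  · simp [PortGraph.discovered] at hroom
  · simpa [PortGraph.discovered, quota] using hroom

section Moves

variable (hI : I.Valid f) (hτ : τ.IsExecution I f)
include hI hτ

theorem follower_succ (h : Settling I τ t v L T new) (hi : i ∈ followers I) :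
    (τ.state (t + 1) i = some (.follower (I.id i) true) ∧
      τ.pos (t + 1) i = (I.G.leave v (T.head?.map Step.port)).1 ∧
      I.id i ∈ L.drop (quota new (I.cap v))) ∨
    (i ∈ settledAt I τ (t + 1) v ∧ I.id i ∈ L.take (quota new (I.cap v))) ∨
    (i ∈ settledAt I τ (t + 1) (τ.pos t i) ∧ i ∈ settledAt I τ t (τ.pos t i) ∧
      τ.pos t i ∉ I.G.discovered v new T) := by
  obtain ⟨e, hs⟩ := h.shepherd
  have hmsg := hs.msg hI hτ
  rcases h.whereabouts i hi with ⟨hstate, rfl, hL⟩ | ⟨hstate, hpos⟩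
  · by_cases htake : I.id i ∈ L.take (quota new (I.cap (τ.pos t i)))
    · have hsettle := follower_settle hτ hi hstate hs.pos.symm hmsg htake
      exact .inr (.inl ⟨mem_settledAt.2 ⟨hi, hsettle⟩, htake⟩)
    · obtain ⟨hstate', hpos'⟩ := follower_join hτ hi hstate hs.pos.symm hmsg htake
      rw [← List.take_append_drop (quota new (I.cap (τ.pos t i))) L, List.mem_append] at hL
      exact .inl ⟨hstate', hpos', hL.resolve_left htake⟩
  · have hstay := hτ.succ_of_terminated (mem_followers.1 hi).1 hstate
    exact .inr (.inr ⟨mem_settledAt.2 ⟨hi, hstay⟩, mem_settledAt.2 ⟨hi, hstate, rfl⟩, hpos⟩)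

theorem mem_settledAt_succ (h : Settling I τ t v L T new) {x : Fin n}
    (hi : i ∈ settledAt I τ (t + 1) x) :
    (x = v ∧ I.id i ∈ L.take (quota new (I.cap v))) ∨
      (i ∈ settledAt I τ t x ∧ x ∉ I.G.discovered v new T) := by
  obtain ⟨hfollower, hstate, hpos⟩ := mem_settledAt.1 hi
  rcases h.follower_succ hI hτ hfollower with ⟨hstate', -⟩ | ⟨hsettled, htake⟩ | ⟨hsettled, hold⟩
  · simp [hstate] at hstate'
  · exact .inl ⟨hpos.symm.trans (mem_settledAt.1 hsettled).2.2, htake⟩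
  · have hstay : τ.pos t i = x := (mem_settledAt.1 hsettled).2.2.symm.trans hpos
    exact .inr (hstay ▸ hold)

theorem card_settledAt_succ_self_le (h : Settling I τ t v L T true) :
    (settledAt I τ (t + 1) v).card ≤ (L.take (I.cap v)).length := by
  refine card_le_of_id_mem hI fun i hi => ?_
  rcases h.mem_settledAt_succ hI hτ hi with ⟨-, htake⟩ | ⟨-, hv⟩
  · exact htake
  · exact absurd (PortGraph.start_mem_discovered v T) hv

theorem card_settledAt_succ_le (h : Settling I τ t v L T new) (x : Fin n) :
    (settledAt I τ (t + 1) x).card ≤ I.cap x := by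
  by_cases hx : new = true ∧ x = v
  · obtain ⟨rfl, rfl⟩ := hx
    exact (h.card_settledAt_succ_self_le hI hτ).trans (List.length_take_le _ _)
  · refine (Finset.card_le_card fun i hi => ?_).trans (h.card_settledAt_le x)
    rcases h.mem_settledAt_succ hI hτ hi with ⟨rfl, htake⟩ | ⟨hold, -⟩
    · have hnew : new = false := by simpa using hx
      simp [hnew, quota] at htake
    · exact hold

theorem state_succ_of_length_lt (h : Settling I τ t v L T new)
    (hL : L.length < quota new (I.cap v)) (hi : i ∈ followers I) : τ.state (t + 1) i = none := by
  rcases h.follower_succ hI hτ hi with ⟨-, -, hdrop⟩ | ⟨hsettled, -⟩ | ⟨hsettled, -⟩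
  · simp [List.drop_eq_nil_of_le hL.le] at hdrop
  · exact (mem_settledAt.1 hsettled).2.1
  · exact (mem_settledAt.1 hsettled).2.1

theorem finish (h : Settling I τ t v L T new) (hL : L.length < quota new (I.cap v)) :
    τ.DispersedAt I (t + 1) := by
  obtain ⟨e, hs⟩ := h.shepherd
  obtain ⟨hstate, hpos⟩ := hs.succ_of_halts hI hτ (decide_eq_true hL)
  have hsettled {i : Fin k} (hi : i ∉ I.byz) (hne : i ≠ I.shepherd) :
      i ∈ settledAt I τ (t + 1) (τ.pos (t + 1) i) :=
    have hi := mem_followers.2 ⟨hi, hne⟩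
    mem_settledAt.2 ⟨hi, h.state_succ_of_length_lt hI hτ hL hi, rfl⟩
  refine ⟨fun i hi => ?_, fun x => ?_⟩
  · by_cases hne : i = I.shepherd
    · exact hne ▸ hstate
    · exact (mem_settledAt.1 (hsettled hi hne)).2.1
  · by_cases hx : x = v
    · obtain ⟨rfl, hcap⟩ : new = true ∧ L.length < I.cap v := by
        cases new
        · simp [quota] at hL
        · exact ⟨rfl, hL⟩
      calc (Finset.univ.filter fun i => i ∉ I.byz ∧ τ.pos (t + 1) i = x).card
        _ ≤ (insert I.shepherd (settledAt I τ (t + 1) x)).card :=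
          Finset.card_le_card fun i hi => by
            obtain ⟨hbyz, hix⟩ := (Finset.mem_filter_univ _).1 hi
            exact Finset.mem_insert.2 (or_iff_not_imp_left.2 fun hne => hix ▸ hsettled hbyz hne)
        _ ≤ (settledAt I τ (t + 1) v).card + 1 := hx ▸ Finset.card_insert_le _ _
        _ ≤ L.length + 1 := Nat.succ_le_succ
          ((h.card_settledAt_succ_self_le hI hτ).trans (List.length_take_le' _ _))
        _ ≤ I.cap x := hx ▸ hcap
    · refine (Finset.card_le_card fun i hi => ?_).trans (h.card_settledAt_succ_le hI hτ x)
      obtain ⟨hbyz, hix⟩ := (Finset.mem_filter_univ _).1 hi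
      exact hix ▸ hsettled hbyz fun hi => hx (by rw [← hix, hi, hpos])

theorem advance {a : Step} (h : Settling I τ t v L (a :: T) new)
    (hL : ¬ L.length < quota new (I.cap v)) :
    Settling I τ (t + 1) (I.G.next v a.port) (L.drop (quota new (I.cap v))) T a.new where
  shepherd :=
    let ⟨_, hs⟩ := h.shepherd
    ⟨_, hs.succ hI hτ (decide_eq_false hL)⟩
  whereabouts i hi := by
    rcases h.follower_succ hI hτ hi with hled | ⟨hsettled, htake⟩ | ⟨hsettled, -, hnew⟩
    · exact .inl hled
    · obtain ⟨-, hstate, hpos⟩ := mem_settledAt.1 hsettled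
      refine .inr ⟨hstate, ?_⟩
      cases new
      · simp [quota] at htake
      · rw [hpos]
        exact (List.nodup_cons.1 h.nodup).1
    · obtain ⟨-, hstate, hpos⟩ := mem_settledAt.1 hsettled
      exact .inr ⟨hstate, fun hmem => hnew (hpos ▸ List.mem_append_right _ hmem)⟩
  card_settledAt_le := h.card_settledAt_succ_le hI hτ
  nodup := h.nodup.of_append_right
  room := by
    have hroom := h.room_cons
    rw [List.length_drop]
    lia

theorem exists_dispersedAt (h : Settling I τ t v L T new) :
    ∃ t' ≤ t + T.length + 1, τ.DispersedAt I t' := by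
  induction T generalizing t v L new with
  | nil => exact ⟨t + 1, le_rfl, h.finish hI hτ h.room_nil⟩
  | cons a T ih =>
    by_cases hL : L.length < quota new (I.cap v)
    · exact ⟨t + 1, by simp, h.finish hI hτ hL⟩
    · obtain ⟨t', ht', hdispersed⟩ := ih (h.advance hI hτ hL)
      exact ⟨t', by rw [List.length_cons]; lia, hdispersed⟩

end Moves

end Settling

/-! ### Exploration -/

/-- At time `t` the shepherd and a herd of more than `f` followers are at the node of a correct
survey `S` that is to be continued; the followers that have not joined started outside the nodes
left along the tour. -/
structure Exploring (I : Instance n k) (τ : Trace n k (algorithm W)) (f t : ℕ) (r : Fin n)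
    (S : Survey) : Prop where
  shepherd : ∃ e, ShepherdAt I τ t (.explore f S) (I.G.dest r S.done, e)
  herd : Herd I τ t (I.G.dest r S.done) {x | x ∈ I.G.sources r S.done} (f + 1)
  survey : I.G.IsSurvey r S

theorem card_heard_lt (t : ℕ) (i : Fin k) : (τ.heard I t i).card < k := by
  rw [card_heard]
  exact (Finset.card_lt_univ_of_notMem (x := i) (by simp)).trans_eq (Fintype.card_fin k)

theorem id_mem_labels_heard (hτ : τ.IsExecution I f) {t : ℕ} {i j : Fin k}
    (hi : i ∉ I.byz ∧ i ≠ j) (hpos : τ.pos t i = τ.pos t j) :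
    I.id i ∈ ((τ.heard I t j).map Sighting.label).toList := by
  rw [Multiset.mem_toList, Trace.heard, Multiset.map_map]
  exact Multiset.mem_map.2 ⟨i, by simp [hi.2, hpos], hτ.label_eq t i hi.1⟩

section Moves

variable (hI : I.Valid f) (hτ : τ.IsExecution I f) {t : ℕ} {r : Fin n} {S : Survey}
include hI hτ

theorem ShepherdAt.scan {v w : Fin n} {D : Set (Fin n)} {rest : List Step} {e : Option ℕ} {q : ℕ}
    {found : Bool} (hs : ShepherdAt I τ t (.scan f S q rest found) (v, e))
    (hherd : Herd I τ t w D (f + 1)) :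
    ∃ found' : Bool, (found' = true ↔ found = true ∨ w ∈ I.G.nodes v rest) ∧
      ShepherdAt I τ (t + rest.length + 1) (.back f S q found')
        (I.G.leave (I.G.dest v rest) (some S.port)) ∧
      Herd I τ (t + rest.length + 1) w D (f + 1) := by
  induction rest generalizing t v e found with
  | nil =>
    refine ⟨_, ?_, hs.succ hI hτ rfl, hherd.wait hI hτ hs rfl⟩
    simp [hherd.herdHere_iff hτ hI hs, PortGraph.nodes, PortGraph.sources, PortGraph.dest]
  | cons a rest ih =>
    obtain ⟨found', hfound', hback⟩ := ih (hs.succ hI hτ rfl) (hherd.wait hI hτ hs rfl)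
    rw [List.length_cons, ← Nat.add_assoc, Nat.add_right_comm t]
    refine ⟨found', ?_, hback⟩
    rw [hfound', Bool.or_eq_true, hherd.herdHere_iff hτ hI hs, PortGraph.nodes_cons, List.mem_cons,
      or_assoc]
    rfl

namespace Exploring

theorem probe (h : Exploring I τ f t r S) {w : Fin n} {q : ℕ}
    (hw : I.G.cross (I.G.dest r S.done) S.port = some (w, q)) :
    ∃ found : Bool, (found = true ↔ w ∈ I.G.nodes r S.tour) ∧
      (∃ e, ShepherdAt I τ (t + S.tour.length + 4)
        (.explore f (if found then S.skip else S.detour q)) (I.G.dest r S.done, e)) ∧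
      Herd I τ (t + S.tour.length + 4) (I.G.dest r S.done) {x | x ∈ I.G.sources r S.done}
        (f + 1) := by
  obtain ⟨e, hs⟩ := h.shepherd
  obtain ⟨hdest, hrotate⟩ : I.G.dest (I.G.dest r S.done) (S.todo ++ S.done) = I.G.dest r S.done ∧
      (w ∈ I.G.nodes (I.G.dest r S.done) (S.todo ++ S.done) ↔ w ∈ I.G.nodes r S.tour) := by
    have htour : I.G.dest (I.G.dest r S.done) S.todo = r := by
      simpa [Survey.tour, PortGraph.dest_append] using h.survey.dest_tour
    exact ⟨by rw [PortGraph.dest_append, htour], PortGraph.mem_nodes_rotate h.survey.dest_tour⟩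
  set u := I.G.dest r S.done
  have hp := PortGraph.lt_deg_of_cross hw
  have hout := PortGraph.leave_of_cross hw
  have hback := PortGraph.leave_of_cross (PortGraph.cross_symm hw)
  have hport : (Phase.explore f S).port W (localView I (u, e)) = some S.port := if_pos hp
  have hupdate (H : Multiset (Sighting Message)) :
      (Phase.explore f S).update (localView I (u, e)) H = .away f S := if_pos hp
  have hs₁ := hs.succ hI hτ rfl
  have hherd₁ := h.herd.lead hI hτ hs rfl
  rw [hport, hout] at hs₁ hherd₁
  rw [hupdate] at hs₁
  have hs₂ : ShepherdAt I τ (t + 2) (.scan f S q (S.todo ++ S.done) false) (u, some S.port) :=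
    hback ▸ hs₁.succ hI hτ rfl
  obtain ⟨found, hfound, hs₃, hherd₃⟩ := hs₂.scan hI hτ (hherd₁.wait hI hτ hs₁ rfl)
  rw [hdest, hout] at hs₃
  have hs₄ := hs₃.succ hI hτ rfl
  have hherd₄ := hherd₃.lead hI hτ hs₃ rfl
  have hport' : (Phase.back f S q found).port W (localView I (w, some q)) = some q := rfl
  rw [hport', hback] at hs₄ hherd₄
  have htime : t + 2 + (S.todo ++ S.done).length + 1 + 1 = t + S.tour.length + 4 := by
    rw [Survey.tour, List.length_append, List.length_append]
    lia
  rw [htime] at hs₄ hherd₄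
  refine ⟨found, by simpa [hrotate] using hfound, ⟨_, hs₄⟩, hherd₄.mono ?_⟩
  exact (Set.subset_insert _ _).trans (Set.subset_insert _ _)

theorem check (h : Exploring I τ f t r S) (hp : S.port < I.G.deg (I.G.dest r S.done)) :
    ∃ S', Exploring I τ f (t + S.tour.length + 4) r S' ∧ S'.done = S.done ∧
      S'.port = S.port + 1 := by
  obtain ⟨w, q, hw⟩ := PortGraph.exists_cross_eq_some hp
  obtain ⟨found, hfound, hs, hherd⟩ := h.probe hI hτ hw
  cases found with
  | true =>
    have hold : I.G.next (I.G.dest r S.done) S.port ∈ I.G.nodes r S.tour :=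
      PortGraph.next_of_cross hw ▸ hfound.1 rfl
    exact ⟨S.skip, ⟨hs, hherd, h.survey.skip hold⟩, rfl, rfl⟩
  | false =>
    have hnew : w ∉ I.G.nodes r S.tour := fun hmem => Bool.false_ne_true (hfound.2 hmem)
    exact ⟨S.detour q, ⟨hs, hherd, h.survey.detour hw hnew⟩, rfl, rfl⟩

theorem advance {l₁ l₂ : List Step} {a : Step} {p : ℕ}
    (h : Exploring I τ f t r ⟨l₁, a :: l₂, p⟩) (hp : I.G.deg (I.G.dest r l₁) ≤ p) :
    Exploring I τ f (t + 1) r ⟨l₁ ++ [a], l₂, 0⟩ := by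
  obtain ⟨e, hs⟩ := h.shepherd
  have hport : (Phase.explore f ⟨l₁, a :: l₂, p⟩).port W (localView I (I.G.dest r l₁, e)) =
      some a.port := if_neg hp.not_gt
  have hupdate (H : Multiset (Sighting Message)) :
      (Phase.explore f ⟨l₁, a :: l₂, p⟩).update (localView I (I.G.dest r l₁, e)) H =
        .explore f ⟨l₁ ++ [a], l₂, 0⟩ := if_neg hp.not_gt
  have hdest : I.G.dest r (l₁ ++ [a]) = (I.G.leave (I.G.dest r l₁) (some a.port)).1 :=
    PortGraph.dest_append _ _ _
  have hsources : {x | x ∈ I.G.sources r (l₁ ++ [a])} ⊆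
      insert (I.G.dest r l₁) {x | x ∈ I.G.sources r l₁} := fun x hx => by
    simpa [PortGraph.sources_append, PortGraph.sources, or_comm] using hx
  have hs' := hs.succ hI hτ rfl
  have hherd' := h.herd.lead hI hτ hs rfl
  rw [hport] at hs' hherd'
  rw [hupdate] at hs'
  refine ⟨hdest ▸ ⟨_, hs'⟩, ?_, h.survey.advance hp⟩
  exact hdest ▸ hherd'.mono hsources

theorem settling {l : List Step} {p : ℕ} (h : Exploring I τ f t r ⟨l, [], p⟩)
    (hp : I.G.deg r ≤ p) : ∃ L, Settling I τ (t + 1) r L l true := by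
  have hdest := h.survey.dest_done
  obtain ⟨e, hs⟩ := h.shepherd
  have hherd := h.herd
  rw [hdest] at hs hherd
  have hpos {i : Fin k} (hi : i ∈ followers I) : τ.pos t i = r := by
    rcases hherd.whereabouts i hi with ⟨-, hpos⟩ | ⟨-, hpos, hstart⟩
    · exact hpos
    · have hdiscovered := h.survey.mem_discovered hp (I.start i)
      exact hpos.trans ((h.survey.mem_sources_or_eq hdiscovered).resolve_left hstart)
  have hport : (Phase.explore f ⟨l, [], p⟩).port W (localView I (r, e)) = none := if_neg hp.not_gt
  have hupdate (H : Multiset (Sighting Message)) :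
      (Phase.explore f ⟨l, [], p⟩).update (localView I (r, e)) H =
        .settle (H.map Sighting.label).toList l true := by
    simp [Phase.update, localView, hp.not_gt, Survey.tour_nil]
  have hs' := hs.succ hI hτ rfl
  rw [hport, hupdate] at hs'
  have hjoin {i : Fin k} (hi : i ∈ followers I) := hherd.join hI hτ hs rfl hi (hpos hi)
  simp only [hport] at hjoin
  refine ⟨_, ⟨_, hs'⟩, fun i hi => ?_, fun x => ?_, ?_, ?_⟩
  · exact .inl ⟨(mem_joined.1 (hjoin hi).1).2, (hjoin hi).2,
      id_mem_labels_heard hτ (mem_followers.1 hi) ((hpos hi).trans hs.pos.symm)⟩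
  · have hempty : settledAt I τ (t + 1) x = ∅ := Finset.eq_empty_of_forall_notMem fun i hi => by
      obtain ⟨hi, hstate, -⟩ := mem_settledAt.1 hi
      simp [(mem_joined.1 (hjoin hi).1).2] at hstate
    simp [hempty]
  · simpa only [Survey.tour_nil] using h.survey.nodup
  · rw [h.survey.sum_map_discovered hp, Multiset.length_toList, Multiset.card_map]
    exact (card_heard_lt t _).trans_le hI.total_cap

theorem exists_settling (h : Exploring I τ f t r S) :
    ∃ t' ≤ t + S.remaining n * (2 * n + 2) + 1, ∃ L T,
      Settling I τ t' r L T true ∧ T.length + 2 ≤ 2 * n := by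
  induction hm : S.remaining n using Nat.strong_induction_on generalizing t S with
  | _ m ih =>
  subst hm
  have hlen := h.survey.length_tour_le
  have hdeg := I.G.deg_le (I.G.dest r S.done)
  by_cases hp : S.port < I.G.deg (I.G.dest r S.done)
  · obtain ⟨S', h', hdone, hport⟩ := h.check hI hτ hp
    have hremaining : S'.remaining n + 1 = S.remaining n := by
      rw [Survey.remaining, Survey.remaining, hdone, hport]
      lia
    obtain ⟨t', ht', hsettling⟩ := ih _ (by lia) h' rfl
    exact ⟨t', by rw [← hremaining, Nat.succ_mul]; lia, hsettling⟩
  · obtain ⟨l₁, _ | ⟨a, l₂⟩, p⟩ := S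
    · rw [h.survey.dest_done, not_lt] at hp
      obtain ⟨L, hL⟩ := h.settling hI hτ hp
      exact ⟨t + 1, by lia, L, l₁, hL, by simpa only [Survey.tour_nil] using hlen⟩
    · have hl : l₁.length < 2 * n - 2 := by
        simp only [Survey.tour, List.length_append, List.length_cons] at hlen
        lia
      have hlt := Survey.remaining_advance_lt (l₂ := l₂) hl a p
      obtain ⟨t', ht', hsettling⟩ := ih _ hlt (h.advance hI hτ (not_lt.1 hp)) rfl
      refine ⟨t', ht'.trans ?_, hsettling⟩
      have hmul := Nat.mul_le_mul_right (2 * n + 2) (Nat.succ_le_of_lt hlt)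
      lia

end Exploring

end Moves

/-! ### Gathering -/

theorem le_card_followers (hI : I.Valid f) : k ≤ (followers I).card + f + 1 := by
  have hcover : (Finset.univ : Finset (Fin k)) ⊆ insert I.shepherd (followers I ∪ I.byz) :=
    fun i _ => by
      rw [Finset.mem_insert, Finset.mem_union, mem_followers]
      tauto
  calc k = (Finset.univ : Finset (Fin k)).card := by simp
    _ ≤ (followers I ∪ I.byz).card + 1 :=
      (Finset.card_le_card hcover).trans (Finset.card_insert_le _ _)
    _ ≤ (followers I).card + I.byz.card + 1 := Nat.succ_le_succ (Finset.card_union_le _ _)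
    _ ≤ (followers I).card + f + 1 := by gcongr; exact hI.card_byz

theorem card_heard_le (hI : I.Valid f) (t : ℕ) : (τ.heard I t I.shepherd).card ≤
    ((followers I).filter fun i => τ.pos t i = τ.pos t I.shepherd).card + f := by
  rw [card_heard]
  refine (Finset.card_le_card (t := (followers I).filter _ ∪ I.byz) fun i hi => ?_).trans
    ((Finset.card_union_le _ _).trans (Nat.add_le_add_left hI.card_byz _))
  simp only [Finset.mem_union, Finset.mem_filter, mem_followers] at hi ⊢
  tauto

theorem gatherPort_two_pow_add {j s : ℕ} (hs : s < 2 ^ j) (ν : LocalView) :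
    gatherPort W (2 ^ j + s) ν =
      uxsPort ν.degree (if s = 0 then 0 else ν.entry.getD 0) ((0 :: W j).getD s 0) := by
  have hlog : Nat.log 2 (2 ^ j + s) = j :=
    Nat.log_eq_of_pow_le_of_lt_pow (Nat.le_add_right _ _) (by rw [pow_succ]; lia)
  simp only [gatherPort, hlog, Nat.add_sub_cancel_left]

/-- At time `t` the shepherd still gathers, and the followers at the nodes where it has been have
joined the herd. -/
structure Gathering (I : Instance n k) (τ : Trace n k (algorithm W)) (f t : ℕ) : Prop where
  shepherd : ShepherdAt I τ t (.gather k f (t + 1)) (τ.pos t I.shepherd, τ.entry t I.shepherd)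
  herd : Herd I τ t (τ.pos t I.shepherd) {x | ∃ s < t, τ.pos s I.shepherd = x} 0

namespace Gathering

theorem le_card_heard {t : ℕ} (hI : I.Valid f) (h : Gathering I τ f t)
    (hvisited : ∀ v, ∃ s ≤ t, τ.pos s I.shepherd = v) :
    k ≤ (τ.heard I t I.shepherd).card + f + 1 := by
  have hsub : followers I ⊆
      Finset.univ.filter fun i => i ≠ I.shepherd ∧ τ.pos t i = τ.pos t I.shepherd := by
    intro i hi
    refine Finset.mem_filter.2 ⟨Finset.mem_univ i, (mem_followers.1 hi).2, ?_⟩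
    rcases h.herd.whereabouts i hi with hjoined | ⟨_, hstart, hunvisited⟩
    · exact hjoined.2
    · obtain ⟨s, hs, hpos⟩ := hvisited (I.start i)
      rcases hs.lt_or_eq with hs | rfl
      · exact absurd ⟨s, hs, hpos⟩ hunvisited
      · exact hstart.trans hpos.symm
  rw [card_heard]
  exact (le_card_followers hI).trans (by gcongr)

section Moves

variable (hI : I.Valid f) (hτ : τ.IsExecution I f) {t : ℕ}
include hI hτ

theorem zero : Gathering I τ f 0 where
  shepherd := ⟨by rw [hτ.state_zero _ hI.shepherd_honest, if_pos rfl], rfl⟩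
  herd.whereabouts i hi := by
    obtain ⟨hbyz, hne⟩ := mem_followers.1 hi
    exact .inr ⟨by rw [hτ.state_zero _ hbyz, if_neg hne], hτ.pos_zero i,
      fun ⟨s, hs, _⟩ => absurd hs (Nat.not_lt_zero s)⟩
  herd.size := Nat.zero_le _

theorem move (h : Gathering I τ f t) :
    (τ.pos (t + 1) I.shepherd, τ.entry (t + 1) I.shepherd) =
      I.G.leave (τ.pos t I.shepherd) (some (gatherPort W (t + 1) (τ.view I t I.shepherd))) :=
  (h.shepherd.succ hI hτ rfl).2

theorem herd_succ (h : Gathering I τ f t) :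
    Herd I τ (t + 1) (τ.pos (t + 1) I.shepherd) {x | ∃ s < t + 1, τ.pos s I.shepherd = x} 0 := by
  have hpos : τ.pos (t + 1) I.shepherd = _ := congrArg Prod.fst (h.move hI hτ)
  rw [hpos]
  refine (h.herd.lead hI hτ h.shepherd rfl).mono ?_
  rintro x ⟨s, hs, rfl⟩
  rcases Nat.lt_succ_iff_lt_or_eq.1 hs with hs | rfl
  · exact .inr ⟨s, hs, rfl⟩
  · exact .inl rfl

theorem succ (h : Gathering I τ f t) (hk : ¬ k ≤ (τ.heard I t I.shepherd).card + f + 1) :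
    Gathering I τ f (t + 1) := by
  have hs := h.shepherd.succ hI hτ rfl
  rw [Phase.update, if_neg hk] at hs
  exact ⟨⟨hs.1, rfl⟩, h.herd_succ hI hτ⟩

theorem exploring (h : Gathering I τ f t) (hf : 3 * f + 2 ≤ k)
    (hk : k ≤ (τ.heard I t I.shepherd).card + f + 1) :
    Exploring I τ f (t + 1) (τ.pos (t + 1) I.shepherd) ⟨[], [], 0⟩ := by
  have hs := h.shepherd.succ hI hτ rfl
  rw [Phase.update, if_pos hk] at hs
  have hjoined : ((followers I).filter fun i => τ.pos t i = τ.pos t I.shepherd) ⊆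
      joined I τ (t + 1) := fun i hi =>
    let ⟨hi, hpos⟩ := Finset.mem_filter.1 hi
    (h.herd.join hI hτ h.shepherd rfl hi hpos).1
  have hsize : f + 1 ≤ (joined I τ (t + 1)).card := by
    have hheard := card_heard_le (τ := τ) hI t
    have hcard := Finset.card_le_card hjoined
    lia
  exact ⟨⟨_, hs.1, rfl⟩, ⟨((h.herd_succ hI hτ).mono (by simp [PortGraph.sources])).whereabouts,
    hsize⟩, .start _⟩

theorem exists_pos_eq {j : ℕ} (hW : IsUXS n (W j)) (hrounds : uxsRounds (W j) ≤ 2 ^ j)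
    (h : ∀ t < 2 ^ (j + 1), Gathering I τ f t) (v : Fin n) :
    ∃ t < 2 ^ (j + 1), τ.pos t I.shepherd = v := by
  obtain ⟨t₀, ht₀⟩ : ∃ t₀, 2 ^ j = t₀ + 1 := Nat.exists_eq_succ_of_ne_zero (by positivity)
  have hlen : (0 :: W j).length ≤ 2 ^ j := hrounds
  let b : ℕ → Fin n × ℕ := fun s =>
    (τ.pos (t₀ + s) I.shepherd, if s = 0 then 0 else (τ.entry (t₀ + s) I.shepherd).getD 0)
  have hb : ∀ s < (0 :: W j).length, b (s + 1) = (I.G.cross (b s).1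
      (uxsPort (I.G.deg (b s).1) (b s).2 ((0 :: W j).getD s 0))).getD ((b s).1, 0) := by
    intro s hs
    have hmove := (h (t₀ + s) (by lia)).move hI hτ
    rw [show t₀ + s + 1 = 2 ^ j + s by lia, gatherPort_two_pow_add (hs.trans_le hlen)] at hmove
    rw [← PortGraph.fst_leave_getD_snd_leave]
    simp only [b, Nat.succ_ne_zero, if_false, show t₀ + (s + 1) = 2 ^ j + s by lia]
    exact congrArg (fun x : Fin n × Option ℕ => (x.1, x.2.getD 0)) hmove
  obtain ⟨s, hs, hv⟩ := I.G.exists_eq_of_mem_visits hb (hW n le_rfl I.G _ v)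
  exact ⟨t₀ + s, by lia, hv⟩

end Moves

end Gathering

theorem exists_exploring (hI : I.Valid f) (hτ : τ.IsExecution I f) (hf : 3 * f + 2 ≤ k) {j : ℕ}
    (hW : IsUXS n (W j)) (hrounds : uxsRounds (W j) ≤ 2 ^ j) :
    ∃ t ≤ 2 ^ (j + 1), ∃ r, Exploring I τ f t r ⟨[], [], 0⟩ := by
  by_contra hnever
  have hfew {t : ℕ} (ht : t < 2 ^ (j + 1)) (h : Gathering I τ f t) :
      ¬ k ≤ (τ.heard I t I.shepherd).card + f + 1 :=
    fun hk => hnever ⟨t + 1, ht, _, h.exploring hI hτ hf hk⟩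
  have hgather : ∀ t < 2 ^ (j + 1), Gathering I τ f t := by
    intro t ht
    induction t with
    | zero => exact .zero hI hτ
    | succ t ih =>
      have h := ih (Nat.lt_of_succ_lt ht)
      exact h.succ hI hτ (hfew (Nat.lt_of_succ_lt ht) h)
  obtain ⟨t, ht⟩ : ∃ t, 2 ^ (j + 1) = t + 1 := Nat.exists_eq_succ_of_ne_zero (by positivity)
  have hlast : t < 2 ^ (j + 1) := by lia
  refine hfew hlast (hgather t hlast) (Gathering.le_card_heard hI (hgather t hlast) fun v => ?_)
  obtain ⟨s, hs, hv⟩ := Gathering.exists_pos_eq hI hτ hW hrounds hgather v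
  exact ⟨s, by lia, hv⟩

/-! ### The whole algorithm -/

theorem solves {j : ℕ} (hf : 3 * f + 2 ≤ k) (hW : IsUXS n (W j))
    (hrounds : uxsRounds (W j) ≤ 2 ^ j) :
    (algorithm W).SolvesByzantineDispersion n k f (2 ^ (j + 1) + 16 * n ^ 3) := by
  intro I hI τ hτ
  obtain ⟨t₁, ht₁, r, hexplore⟩ := exists_exploring hI hτ hf hW hrounds
  obtain ⟨t₂, ht₂, L, T, hsettle, hT⟩ := hexplore.exists_settling hI hτ
  obtain ⟨t₃, ht₃, hdispersed⟩ := hsettle.exists_dispersedAt hI hτ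
  refine ⟨t₃, ?_, hdispersed⟩
  have hremaining : Survey.remaining n ⟨[], [], 0⟩ = (2 * n - 2) * (n + 1) + n := rfl
  have hcubic : ((2 * n - 2) * (n + 1) + n) * (2 * n + 2) + 2 * n ≤ 16 * n ^ 3 := by
    obtain ⟨m, rfl⟩ : ∃ m, n = m + 1 := Nat.exists_eq_succ_of_ne_zero r.pos.ne'
    rw [show 2 * (m + 1) - 2 = 2 * m by lia]
    nlinarith [Nat.zero_le (m ^ 3), Nat.zero_le (m ^ 2)]
  rw [hremaining] at ht₂
  lia

end Herding

theorem theorem2_general : ∃ (C : ℕ) (A : Algorithm), ∀ n k f : ℕ, (f : ℝ) < ((k : ℝ) - 1) / 3 →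
    ∀ x, IsUXS n x → A.SolvesByzantineDispersion n k f (C * (uxsRounds x + n ^ 3)) := by
  choose W hW using fun j => exists_isUXS_of_uxsRounds_le (2 ^ j)
  refine ⟨16, Herding.algorithm W, fun n k f hf x hx I hI τ hτ => ?_⟩
  have hfk : 3 * f + 2 ≤ k := by
    have h : (3 * f + 1 : ℝ) < k := by linarith
    exact_mod_cast h
  have hbudget : 2 ^ Nat.log 2 (uxsRounds x) ≤ uxsRounds x :=
    Nat.pow_log_le_self 2 (Nat.succ_ne_zero _)
  obtain ⟨huxs, hrounds⟩ := hW (Nat.log 2 (uxsRounds x) + 1) n x hx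
    (Nat.lt_pow_succ_log_self one_lt_two _).le
  obtain ⟨t, ht, hdispersed⟩ := Herding.solves hfk huxs hrounds I hI τ hτ
  refine ⟨t, ht.trans ?_, hdispersed⟩
  rw [pow_succ, pow_succ]
  lia

theorem theorem2 :
    ∃ C : ℕ, ∀ U : ℕ → List ℤ, (∀ n, IsUXS n (U n)) →
      ∃ A : Algorithm, ∀ n k f : ℕ, (f : ℝ) < ((k : ℝ) - 1) / 3 →
        A.SolvesByzantineDispersion n k f (C * (uxsRounds (U n) + n ^ 3)) := by
  obtain ⟨C, A, hA⟩ := theorem2_general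
  exact ⟨C, fun U hU => ⟨A, fun n k f hf => hA n k f hf (U n) (hU n)⟩⟩
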